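/- Let $X$ be a compact metric space, $f\colon X\to X$ a homeomorphism, and $\mathcal A\colon X\times\mathbb Z\to \mathrm{GL}(d,\mathbb R)$ a continuous linear cocycle over $f$: $\mathcal A(x,0)=\mathrm{Id}$, $\mathcal A(x,n+k)=\mathcal A(f^k(x),n)\,\mathcal A(x,k)$ for all $n,k\in\mathbb Z$, and $\mathcal A(\cdot,n)$ is continuous for each $n$. A point $x\in X$ is called \emph{regular} if there are numbers $\chi_1(x)>\dots>\chi_{s(x)}(x)$ (the Lyapunov exponents) and a splitting $\mathbb R^d=\bigoplus_{i=1}^{s(x)}E_i(x)$ into nonzero subspaces (the Oseledets splitting) such that: (a) $\lim_{n\to\pm\infty}\frac1n\log\|\mathcal A(x,n)v\|=\chi_i(x)$ for every $i$ and every nonzero $v\in E_i(x)$; (b) for every partition of $\{1,\dots,s(x)\}$ into two nonempty sets $I,J$, $$\lim_{n\to\pm\infty}\frac1{|n|}\log\measuredangle\Big(\mathcal A(x,n)\bigoplus_{i\in I}E_i(x),\ \mathcal A(x,n)\bigoplus_{j\in J}E_j(x)\Big)=0,$$ where the angle between two subspaces is the least angle between nonzero vectors of the two subspaces. The cocycle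 is \emph{completely regular} if every $x\in X$ is regular and the exponents and their multiplicities do not depend on $x$: there are $\chi_1>\dots>\chi_s$ and positive integers $d_1,\dots,d_s$ with $\sum_i d_i=d$ such that, for every $x\in X$, the Lyapunov exponents at $x$ are $\chi_1,\dots,\chi_s$ and $\dim E_i(x)=d_i$. **Theorem.** Let $\mathcal A$ be a completely regular cocycle over a homeomorphism $f$ of a compact metric space $X$, with exponents $\chi_1>\dots>\chi_s$ and Oseledets splitting $\mathbb R^d=\bigoplus_{i=1}^sE_i(x)$, $x\in X$. Then for each $i$ with $1\le i\le s$: 1. the subspace $E_i(x)$ depends continuously on $x$ (as a point of the Grassmannian, i.e. the orthogonal projection onto $E_i(x)$ is a continuous function of $x$); 2. the limits $\lim_{n\to\pm\infty}\frac1n\log\|\mathcal A(x,n)|E_i(x)\|=\chi_i$ and $\lim_{n\to\pm\infty}\frac1n\log m(\mathcal A(x,n)|E_i(x))=\chi_i$ are both uniform in $x$, where $m(L)=\|L^{-1}\|^{-1}$ is the co-norm: for every $\varepsilon>0$ there is $N$ such that, for all $n\in\mathbb Z$ with $|n|>N$ and all $x\in X$, both $$\frac1n\log m(\mathcal A(x,n)|E_i(x))\quad\text{and}\quad\frac1n\log\|\mathcal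 A(x,n)|E_i(x)\|$$ lie in $[\chi_i-\varepsilon,\chi_i+\varepsilon]$. -/

import Mathlib

open Filter Topology
open scoped MatrixGroups

noncomputable section

/-- A continuous linear cocycle over a homeomorphism `f` of `X`, with values in `GL(d, ℝ)`. -/
structure LinearCocycle {X : Type*} [TopologicalSpace X] (f : X ≃ₜ X) (d : ℕ) where
  toFun : X → ℤ → GL (Fin d) ℝ
  map_zero' : ∀ x, toFun x 0 = 1
  map_add' : ∀ x (n k : ℤ), toFun x (n + k) = toFun ((f ^ k) x) n * toFun x k
  continuous' : ∀ n : ℤ, Continuous fun x => toFun x n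

/-- The linear automorphism of Euclidean space `ℝ^d` given by an invertible matrix. -/
def glEquiv {d : ℕ} (g : GL (Fin d) ℝ) :
    EuclideanSpace ℝ (Fin d) ≃L[ℝ] EuclideanSpace ℝ (Fin d) :=
  ContinuousLinearEquiv.ofUnit
    (Units.map (Matrix.toEuclideanCLM (n := Fin d) (𝕜 := ℝ) : _ →* _) g)

/-- The operator norm of the restriction `L|E : E → L(E)`. -/
def restrNorm {d : ℕ} (L : EuclideanSpace ℝ (Fin d) ≃L[ℝ] EuclideanSpace ℝ (Fin d))
    (E : Submodule ℝ (EuclideanSpace ℝ (Fin d))) : ℝ :=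
  ‖(L.submoduleMap E).toContinuousLinearMap‖

/-- The co-norm `m(L|E) = ‖(L|E)⁻¹‖⁻¹` of the restriction `L|E : E → L(E)`. -/
def restrConorm {d : ℕ} (L : EuclideanSpace ℝ (Fin d) ≃L[ℝ] EuclideanSpace ℝ (Fin d))
    (E : Submodule ℝ (EuclideanSpace ℝ (Fin d))) : ℝ :=
  ‖(L.submoduleMap E).symm.toContinuousLinearMap‖⁻¹

/-- The least angle between nonzero vectors of two subspaces. -/
def subspaceAngle {d : ℕ} (F G : Submodule ℝ (EuclideanSpace ℝ (Fin d))) : ℝ :=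
  sInf {θ : ℝ | ∃ u ∈ F, ∃ v ∈ G, u ≠ 0 ∧ v ≠ 0 ∧ θ = InnerProductGeometry.angle u v}

/-- The two-sided limit `u n → l` as `n → +∞` and as `n → -∞`. -/
def TendstoPlusMinus (u : ℤ → ℝ) (l : ℝ) : Prop :=
  Tendsto u atTop (𝓝 l) ∧ Tendsto u atBot (𝓝 l)

/-- A field of subspaces is continuous as a map to the Grassmannian, whose topology is the one
given by the distance `‖P_F - P_G‖` between orthogonal projections. -/
def ContinuousSubspaces {X : Type*} [TopologicalSpace X] {d : ℕ}
    (E : X → Submodule ℝ (EuclideanSpace ℝ (Fin d))) : Prop :=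
  Continuous fun x => (E x).starProjection

namespace LinearCocycle

variable {X : Type*} [TopologicalSpace X] {f : X ≃ₜ X} {d : ℕ}

/-- The matrix `A(x, n)` acting on Euclidean space. -/
def act (A : LinearCocycle f d) (x : X) (n : ℤ) :
    EuclideanSpace ℝ (Fin d) ≃L[ℝ] EuclideanSpace ℝ (Fin d) :=
  glEquiv (A.toFun x n)

/-- The numbers `χ 0 > χ 1 > ⋯` are the Lyapunov exponents of `A` at `x`, and the subspaces
`E 0, E 1, …` form the Oseledets splitting at `x`. -/
structure IsOseledetsSplitting (A : LinearCocycle f d) (x : X) {s : ℕ} (χ : Fin s → ℝ)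
    (E : Fin s → Submodule ℝ (EuclideanSpace ℝ (Fin d))) : Prop where
  strictAnti : StrictAnti χ
  ne_bot : ∀ i, E i ≠ ⊥
  isInternal : DirectSum.IsInternal E
  exponent : ∀ i, ∀ v ∈ E i, v ≠ 0 →
    TendstoPlusMinus (fun n : ℤ => 1 / (n : ℝ) * Real.log ‖A.act x n v‖) (χ i)
  angle : ∀ I J : Finset (Fin s), I.Nonempty → J.Nonempty → Disjoint I J →
    I ∪ J = Finset.univ →
    TendstoPlusMinus (fun n : ℤ => 1 / |(n : ℝ)| * Real.log (subspaceAngle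
      ((⨆ i ∈ I, E i).map (A.act x n).toLinearEquiv.toLinearMap)
      ((⨆ j ∈ J, E j).map (A.act x n).toLinearEquiv.toLinearMap))) 0

/-- Regular (equivalently, Lyapunov-Perron regular) points of a cocycle. -/
def IsRegularPoint (A : LinearCocycle f d) (x : X) : Prop :=
  ∃ (s : ℕ) (χ : Fin s → ℝ) (E : Fin s → Submodule ℝ (EuclideanSpace ℝ (Fin d))),
    A.IsOseledetsSplitting x χ E

/-- The Lyapunov spectrum of `A` at `x` consists of the exponents `χ i` with multiplicities
`m i`. -/
def HasLyapunovSpectrum (A : LinearCocycle f d) (x : X) {s : ℕ} (χ : Fin s → ℝ)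
    (m : Fin s → ℕ) : Prop :=
  ∃ E : Fin s → Submodule ℝ (EuclideanSpace ℝ (Fin d)),
    A.IsOseledetsSplitting x χ E ∧ ∀ i, Module.finrank ℝ (E i) = m i

/-- Complete regularity: every point is regular, and the Lyapunov spectrum does not depend on
the point. -/
def IsCompletelyRegular (A : LinearCocycle f d) : Prop :=
  (∀ x, A.IsRegularPoint x) ∧
  ∃ (s : ℕ) (χ : Fin s → ℝ) (m : Fin s → ℕ),
    StrictAnti χ ∧ (∀ i, 0 < m i) ∧ ∑ i, m i = d ∧ ∀ x, A.HasLyapunovSpectrum x χ m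

end LinearCocycle

end

/-! ### Exponential growth of sequences and sums of vectors. -/

section Growth

/-! Let `lam` differ from every exponent. For `v ≠ 0` the rescaled norm `e^{-lam n} ‖A(x,n) v‖` is
unbounded over `n ∈ ℤ`: a component with exponent above `lam` makes it blow up forward in time, one
with exponent below `lam` backward (`exists_lt_scaledNorm`). Compactness of `X` times the unit
sphere makes this uniform: from any point, any vector at least doubles within a time window `|k| ≤
N` (`exists_two_mul_norm_le`). Hence a bounded rescaled half-orbit cannot come close to its supremum
after time `N`, and so is at most `C ‖v‖` with `C` independent of `x` and `v`.

For small `δ`, `E i x` is therefore exactly the set of `v` satisfying such bounds forward with `lam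
= χ i + δ` and backward with `lam = χ i - δ` (`exists_mem_iff_scaledNorm_le`). These conditions are
closed in `(x, v)`, and complementary subspace fields with closed graphs over a compact space are
continuous. The same bounds, read from both ends of an orbit segment, pin `‖A(x,n) v‖` between `C⁻¹
e^{χ n - δ|n|} ‖v‖` and `C e^{χ n + δ|n|} ‖v‖` with `χ = χ i`, which gives the uniform limits. -/

lemma tendsto_exp_mul_atTop_of_log {a : ℕ → ℝ} (ha : ∀ n, 0 < a n) {ρ μ : ℝ}
    (h : Tendsto (fun n : ℕ => 1 / (n : ℝ) * Real.log (a n)) atTop (𝓝 ρ)) (hμ : μ < ρ) :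
    Tendsto (fun n : ℕ => Real.exp (-μ * n) * a n) atTop atTop := by
  have h1 : Tendsto (fun n : ℕ => (n : ℝ) * (1 / (n : ℝ) * Real.log (a n) - μ)) atTop atTop :=
    tendsto_natCast_atTop_atTop.atTop_mul_pos (sub_pos.2 hμ) (h.sub_const μ)
  refine (Real.tendsto_exp_atTop.comp h1).congr' ?_
  filter_upwards [eventually_gt_atTop 0] with n hn
  have hn' : (n : ℝ) ≠ 0 := by positivity
  rw [Function.comp_apply, ← Real.exp_log (ha n), ← Real.exp_add, Real.exp_log (ha n)]
  congr 1
  field_simp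
  ring

lemma tendsto_exp_mul_zero_of_log {a : ℕ → ℝ} (ha : ∀ n, 0 < a n) {ρ μ : ℝ}
    (h : Tendsto (fun n : ℕ => 1 / (n : ℝ) * Real.log (a n)) atTop (𝓝 ρ)) (hμ : ρ < μ) :
    Tendsto (fun n : ℕ => Real.exp (-μ * n) * a n) atTop (𝓝 0) := by
  have h1 : Tendsto (fun n : ℕ => (n : ℝ) * (1 / (n : ℝ) * Real.log (a n) - μ)) atTop atBot :=
    tendsto_natCast_atTop_atTop.atTop_mul_neg (sub_neg.2 hμ) (h.sub_const μ)
  refine (Real.tendsto_exp_atBot.comp h1).congr' ?_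
  filter_upwards [eventually_gt_atTop 0] with n hn
  have hn' : (n : ℝ) ≠ 0 := by positivity
  rw [Function.comp_apply, ← Real.exp_log (ha n), ← Real.exp_add, Real.exp_log (ha n)]
  congr 1
  field_simp
  ring

variable {V ι : Type*} [NormedAddCommGroup V] [NormedSpace ℝ V] [Fintype ι]

/-- A sum of vectors with distinct exponential growth rates grows at least as fast as each of its
nonzero terms. -/
lemma tendsto_norm_sum_atTop (g : ℕ → V ≃L[ℝ] V) {ρ : ι → ℝ} (hρ : Function.Injective ρ)
    (w : ι → V)
    (hw : ∀ j, w j ≠ 0 → Tendsto (fun n : ℕ => 1 / (n : ℝ) * Real.log ‖g n (w j)‖) atTop (𝓝 (ρ j)))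
    {lam : ℝ} {j : ι} (hj : w j ≠ 0) (hlam : lam < ρ j) :
    Tendsto (fun n : ℕ => Real.exp (-lam * n) * ‖g n (∑ k, w k)‖) atTop atTop := by
  classical
  have hpos : ∀ k, w k ≠ 0 → ∀ n, 0 < ‖g n (w k)‖ := fun k hk n => by
    simpa using hk
  obtain ⟨j₀, hj₀, hmax⟩ := (Finset.univ.filter fun k => w k ≠ 0).exists_max_image ρ
    ⟨j, by simp [hj]⟩
  simp only [Finset.mem_filter, Finset.mem_univ, true_and] at hj₀ hmax
  have hlam₀ : lam < ρ j₀ := hlam.trans_le (hmax j hj)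
  -- At a rate `μ` separating the top rate `ρ j₀` from `lam` and all smaller rates, the `j₀` term
  -- blows up while the others vanish.
  obtain ⟨μ, hμ, hlamμ, hother⟩ : ∃ μ, μ < ρ j₀ ∧ lam < μ ∧ ∀ k, ρ k < ρ j₀ → ρ k < μ := by
    have h : ∀ᶠ μ in 𝓝[<] (ρ j₀), μ < ρ j₀ ∧ lam < μ ∧ ∀ k, ρ k < ρ j₀ → ρ k < μ := by
      refine Eventually.and self_mem_nhdsWithin (Eventually.and ?_ ?_)
      · exact mem_nhdsWithin_of_mem_nhds (Ioi_mem_nhds hlam₀)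
      · refine eventually_all.2 fun k => ?_
        by_cases hk : ρ k < ρ j₀
        · filter_upwards [mem_nhdsWithin_of_mem_nhds (Ioi_mem_nhds hk)] with μ hμ _ using hμ
        · exact Eventually.of_forall fun _ h => absurd h hk
    exact h.exists
  have hsmall : Tendsto (fun n : ℕ => ∑ k ∈ Finset.univ.erase j₀,
      Real.exp (-μ * n) * ‖g n (w k)‖) atTop (𝓝 0) := by
    rw [← Finset.sum_const_zero (s := Finset.univ.erase j₀)]
    refine tendsto_finsetSum _ fun k hk => ?_
    by_cases hwk : w k = 0
    · simp [hwk]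
    · refine tendsto_exp_mul_zero_of_log (hpos k hwk) (hw k hwk) (hother k ?_)
      exact lt_of_le_of_ne (hmax k hwk) (hρ.ne (Finset.ne_of_mem_erase hk))
  have hbig := tendsto_exp_mul_atTop_of_log (hpos j₀ hj₀) (hw j₀ hj₀) hμ
  have hdiff := hbig.atTop_add hsmall.neg
  refine tendsto_atTop_mono (fun n => ?_) hdiff
  have hsum : ‖g n (w j₀)‖ - ∑ k ∈ Finset.univ.erase j₀, ‖g n (w k)‖ ≤ ‖g n (∑ k, w k)‖ := by
    rw [← Finset.add_sum_erase _ _ (Finset.mem_univ j₀), map_add, map_sum]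
    have h1 := norm_sub_norm_le (g n (w j₀)) (-∑ k ∈ Finset.univ.erase j₀, g n (w k))
    have h2 := norm_sum_le (Finset.univ.erase j₀) fun k => g n (w k)
    rw [norm_neg, sub_neg_eq_add] at h1
    linarith
  calc Real.exp (-μ * n) * ‖g n (w j₀)‖ +
        -∑ k ∈ Finset.univ.erase j₀, Real.exp (-μ * n) * ‖g n (w k)‖
      = Real.exp (-μ * n) * (‖g n (w j₀)‖ - ∑ k ∈ Finset.univ.erase j₀, ‖g n (w k)‖) := by
        rw [← Finset.mul_sum]; ring
    _ ≤ Real.exp (-μ * n) * ‖g n (∑ k, w k)‖ := by gcongr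
    _ ≤ Real.exp (-lam * n) * ‖g n (∑ k, w k)‖ := by gcongr

/-- If every late term of a bounded sequence is at most half of another term, then the sequence is
bounded by its initial terms. -/
lemma le_of_two_mul_le_of_bddAbove {a : ℕ → ℝ} {N : ℕ} {c : ℝ} (hc : 0 ≤ c)
    (hbdd : BddAbove (Set.range a)) (hinit : ∀ m < N, a m ≤ c)
    (hdouble : ∀ n, N ≤ n → ∃ m, 2 * a n ≤ a m) (n : ℕ) : a n ≤ c := by
  by_contra! hn
  have hsup : a n ≤ sSup (Set.range a) := le_csSup hbdd ⟨n, rfl⟩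
  -- A term above half the supremum cannot be doubled; being also above `c`, it is a late term,
  -- which can.
  obtain ⟨_, ⟨m, rfl⟩, hm⟩ := exists_lt_of_lt_csSup (Set.range_nonempty a)
    (b := max c (sSup (Set.range a) / 2)) (max_lt (by linarith) (by linarith))
  obtain ⟨hm₁, hm₂⟩ := max_lt_iff.1 hm
  obtain ⟨k, hk⟩ := hdouble m (by by_contra! h; linarith [hinit m h])
  have : a k ≤ sSup (Set.range a) := le_csSup hbdd ⟨k, rfl⟩
  linarith

end Growth

/-! ### Continuity of subspace fields from closed graphs. -/

section Grassmannian

/-- A function into a proper metric space with closed graph and bounded range is continuous. -/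
lemma continuous_of_isClosed_graph_of_bounded {X V : Type*} [TopologicalSpace X]
    [MetricSpace V] [ProperSpace V] {g : X → V} (hg : IsClosed {p : X × V | g p.1 = p.2})
    (hb : Bornology.IsBounded (Set.range g)) : Continuous g := by
  have hK : IsCompact (closure (Set.range g)) := hb.isCompact_closure
  have : CompactSpace (closure (Set.range g)) := isCompact_iff_compactSpace.1 hK
  refine continuous_iff_isClosed.2 fun C hC => ?_
  have h : IsClosed {p : X × closure (Set.range g) | g p.1 = p.2 ∧ (p.2 : V) ∈ C} :=
    (hg.preimage (f := fun p : X × closure (Set.range g) => (p.1, (p.2 : V)))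
      (by fun_prop)).inter (hC.preimage (f := fun p : X × closure (Set.range g) => (p.2 : V))
      (by fun_prop))
  -- The preimage of `C` is the projection of a closed set along the compact factor.
  convert isClosedMap_fst_of_compactSpace _ h
  ext x
  constructor
  · exact fun hx => ⟨(x, ⟨g x, subset_closure ⟨x, rfl⟩⟩), ⟨rfl, hx⟩, rfl⟩
  · rintro ⟨⟨x, u⟩, ⟨h1, h2⟩, rfl⟩
    exact Set.mem_preimage.2 (h1 ▸ h2)

variable {X V ι : Type*} [TopologicalSpace X] [CompactSpace X]
  [NormedAddCommGroup V] [InnerProductSpace ℝ V] [FiniteDimensional ℝ V] [Fintype ι]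

/-- Complementary fields of subspaces with closed graphs over a compact space are continuous. -/
theorem continuous_starProjection_of_isClosed [DecidableEq ι] (E : ι → X → Submodule ℝ V)
    (hclosed : ∀ i, IsClosed {p : X × V | p.2 ∈ E i p.1})
    (hint : ∀ x, DirectSum.IsInternal fun i => E i x) (i : ι) :
    Continuous fun x => (E i x).starProjection := by
  have hex : ∀ x v, ∃ w : ι → V, (∀ j, w j ∈ E j x) ∧ ∑ j, w j = v := by
    intro x v
    obtain ⟨w, hw, hsum⟩ := (Submodule.mem_iSup_iff_exists_finsupp (fun i => E i x) v).1
      ((hint x).submodule_iSup_eq_top ▸ Submodule.mem_top)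
    exact ⟨w, hw, by rw [← hsum, Finsupp.sum_fintype _ _ fun _ => rfl]⟩
  have huniq : ∀ x (w : ι → V), (∀ j, w j ∈ E j x) → ∑ j, w j = 0 → w = 0 := by
    intro x w hw hsum
    funext j
    exact (iSupIndep_iff_finsetSum_eq_zero_imp_eq_zero _).1 (hint x).submodule_iSupIndep
      Finset.univ w (fun k _ => hw k) hsum j (Finset.mem_univ j)
  have hgraph : IsClosed {p : X × (ι → V) | ∀ j, p.2 j ∈ E j p.1} := by
    rw [Set.ofPred_forall]
    exact isClosed_iInter fun j => (hclosed j).preimage (f := fun p : X × (ι → V) => (p.1, p.2 j))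
      (by fun_prop)
  -- `c` bounds `‖∑ j, w j‖` from below over the compact bundle of unit tuples, where independence
  -- makes it positive. Thus the components of a vector are bounded uniformly in `x`.
  obtain ⟨c, hc, hbound⟩ : ∃ c > 0, ∀ x (w : ι → V), (∀ j, w j ∈ E j x) →
      c * ‖w‖ ≤ ‖∑ j, w j‖ := by
    have hK : IsCompact ({p : X × (ι → V) | ∀ j, p.2 j ∈ E j p.1} ∩
        Set.univ ×ˢ Metric.sphere 0 1) :=
      (isCompact_univ.prod (isCompact_sphere 0 1)).inter_left hgraph
    have hmin : ∃ c > 0, ∀ p ∈ ({p : X × (ι → V) | ∀ j, p.2 j ∈ E j p.1} ∩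
        Set.univ ×ˢ Metric.sphere 0 1), c ≤ ‖∑ j, p.2 j‖ := by
      refine hK.exists_forall_le' (f := fun p : X × (ι → V) => ‖∑ j, p.2 j‖)
        (by fun_prop) fun p hp => norm_pos_iff.2 fun h0 => ?_
      have := huniq p.1 p.2 hp.1 h0
      simpa [this] using hp.2
    obtain ⟨c, hc, h⟩ := hmin
    refine ⟨c, hc, fun x w hw => ?_⟩
    by_cases hw0 : w = 0
    · simp [hw0]
    have hpos : 0 < ‖w‖ := norm_pos_iff.2 hw0
    have h1 := h (x, ‖w‖⁻¹ • w) ⟨fun j => (E j x).smul_mem _ (hw j), Set.mem_univ _, by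
      simp [norm_smul, hpos.ne']⟩
    simp only [Pi.smul_apply, ← Finset.smul_sum, norm_smul, norm_inv, norm_norm] at h1
    rwa [inv_mul_eq_div, le_div_iff₀ hpos] at h1
  choose w hwmem hwsum using hex
  have hw : ∀ v, Continuous fun x => w x v := by
    intro v
    refine continuous_of_isClosed_graph_of_bounded ?_ ?_
    · have h : {p : X × (ι → V) | w p.1 v = p.2} =
          {p | ∀ j, p.2 j ∈ E j p.1} ∩ {p | ∑ j, p.2 j = v} := by
        ext ⟨x, u⟩
        constructor
        · intro (h : w x v = u)
          subst h
          exact ⟨hwmem x v, hwsum x v⟩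
        · rintro ⟨h1, h2⟩
          refine sub_eq_zero.1 (huniq x _ (fun j => (E j x).sub_mem (hwmem x v j) (h1 j)) ?_)
          simpa [hwsum, sub_eq_zero] using h2.symm
      rw [h]
      exact hgraph.inter (isClosed_eq (by fun_prop) continuous_const)
    · refine (Metric.isBounded_closedBall (x := (0 : ι → V)) (r := ‖v‖ / c)).subset ?_
      rintro _ ⟨x, rfl⟩
      rw [mem_closedBall_zero_iff, le_div_iff₀' hc, ← hwsum x v]
      simpa only [hwsum] using hbound x _ (hwmem x v)
  rw [continuous_clm_apply]
  intro v
  refine continuous_of_isClosed_graph_of_bounded ?_ ?_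
  · have h : {p : X × V | (E i p.1).starProjection v = p.2} =
        {p | p.2 ∈ E i p.1} ∩ ⋂ z, {p | inner ℝ (v - p.2) (w p.1 z i) = 0} := by
      ext ⟨x, u⟩
      simp only [Set.mem_inter_iff, Set.mem_iInter]
      constructor
      · rintro (rfl : (E i x).starProjection v = u)
        exact ⟨Submodule.starProjection_apply_mem _ _,
          fun z => Submodule.starProjection_inner_eq_zero _ _ (hwmem x z i)⟩
      · rintro ⟨h1, h2⟩
        refine (Submodule.eq_starProjection_of_mem_of_inner_eq_zero h1 fun z hz => ?_)
        have hz' : w x z = Pi.single i z := by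
          refine sub_eq_zero.1 (huniq x _ (fun j => (E j x).sub_mem (hwmem x z j) ?_) ?_)
          · rcases eq_or_ne j i with rfl | hj
            · simpa using hz
            · simp [hj]
          · simp [hwsum]
        simpa [hz'] using h2 z
    rw [h]
    refine (hclosed i).inter (isClosed_iInter fun z => isClosed_eq ?_ continuous_const)
    have := hw z
    fun_prop
  · refine (Metric.isBounded_closedBall (x := (0 : V)) (r := ‖v‖)).subset ?_
    rintro _ ⟨x, rfl⟩
    simpa using (E i x).norm_starProjection_apply_le v

end Grassmannian

/-! ### Rescaled norms along orbits. -/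

namespace LinearCocycle

variable {X : Type*} {d : ℕ}

section Basic

variable [TopologicalSpace X] {f : X ≃ₜ X} (A : LinearCocycle f d)

lemma act_apply (x : X) (n : ℤ) (v : EuclideanSpace ℝ (Fin d)) :
    A.act x n v = Matrix.toEuclideanCLM (n := Fin d) (𝕜 := ℝ) (A.toFun x n).val v := rfl

lemma act_zero (x : X) (v : EuclideanSpace ℝ (Fin d)) : A.act x 0 v = v := by
  rw [act_apply, A.map_zero', Units.val_one, map_one]
  rfl

lemma act_add (x : X) (n k : ℤ) (v : EuclideanSpace ℝ (Fin d)) :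
    A.act x (n + k) v = A.act ((f ^ k) x) n (A.act x k v) := by
  simp only [act_apply]
  rw [A.map_add', Units.val_mul, map_mul]
  rfl

lemma continuous_act (n : ℤ) :
    Continuous fun x => (A.act x n : EuclideanSpace ℝ (Fin d) →L[ℝ] EuclideanSpace ℝ (Fin d)) := by
  have h : Continuous (Matrix.toEuclideanCLM (n := Fin d) (𝕜 := ℝ)) :=
    (Matrix.toEuclideanCLM (n := Fin d) (𝕜 := ℝ)).toAlgEquiv.toLinearMap.continuous_of_finiteDimensional
  exact h.comp (Units.continuous_val.comp (A.continuous' n))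

/-- The norm of `A(x, n) v` rescaled by `e^{-λ n}`. -/
noncomputable def scaledNorm (lam : ℝ) (x : X) (v : EuclideanSpace ℝ (Fin d)) (n : ℤ) : ℝ :=
  Real.exp (-lam * n) * ‖A.act x n v‖

lemma scaledNorm_zero (lam : ℝ) (x : X) (v : EuclideanSpace ℝ (Fin d)) :
    A.scaledNorm lam x v 0 = ‖v‖ := by
  simp [scaledNorm, act_zero]

lemma scaledNorm_smul (lam : ℝ) (x : X) (c : ℝ) (v : EuclideanSpace ℝ (Fin d)) (n : ℤ) :
    A.scaledNorm lam x (c • v) n = |c| * A.scaledNorm lam x v n := by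
  simp only [scaledNorm, map_smul, norm_smul, Real.norm_eq_abs]
  ring

lemma scaledNorm_act (lam : ℝ) (x : X) (v : EuclideanSpace ℝ (Fin d)) (n k : ℤ) :
    A.scaledNorm lam ((f ^ k) x) (A.act x k v) n =
      Real.exp (lam * k) * A.scaledNorm lam x v (n + k) := by
  rw [scaledNorm, scaledNorm, ← act_add, ← mul_assoc, ← Real.exp_add]
  congr 2
  push_cast
  ring

lemma continuous_scaledNorm (lam : ℝ) (n : ℤ) :
    Continuous fun p : X × EuclideanSpace ℝ (Fin d) => A.scaledNorm lam p.1 p.2 n := by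
  have h : Continuous fun p : X × EuclideanSpace ℝ (Fin d) => A.act p.1 n p.2 :=
    ((A.continuous_act n).comp continuous_fst).clm_apply continuous_snd
  exact continuous_const.mul h.norm

lemma exists_scaledNorm_le [CompactSpace X] (lam : ℝ) (N : ℕ) :
    ∃ C : ℝ, 0 < C ∧ ∀ x v (k : ℤ), |k| ≤ N → A.scaledNorm lam x v k ≤ C * ‖v‖ := by
  have h : ∀ k : ℤ, ∃ C : ℝ, 0 ≤ C ∧ ∀ x v, A.scaledNorm lam x v k ≤ C * ‖v‖ := by
    intro k
    obtain ⟨C, hC⟩ := isCompact_univ.exists_bound_of_continuousOn (A.continuous_act k).continuousOn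
    refine ⟨Real.exp (-lam * k) * max C 0, by positivity, fun x v => ?_⟩
    rw [scaledNorm, mul_assoc]
    gcongr
    exact ContinuousLinearMap.le_of_opNorm_le
      (A.act x k : EuclideanSpace ℝ (Fin d) →L[ℝ] EuclideanSpace ℝ (Fin d))
      ((hC x (Set.mem_univ x)).trans (le_max_left _ _)) v
  choose C hC0 hC using h
  refine ⟨∑ k ∈ Finset.Icc (-(N : ℤ)) N, C k + 1,
    add_pos_of_nonneg_of_pos (Finset.sum_nonneg fun k _ => hC0 k) one_pos, fun x v k hk => ?_⟩
  refine (hC k x v).trans ?_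
  gcongr
  have := Finset.single_le_sum (f := C) (fun k _ => hC0 k) (Finset.mem_Icc.2 (abs_le.1 hk))
  linarith

end Basic

/-! ### Growth and decay of rescaled norms at a regular point. -/

section Oseledets

variable [TopologicalSpace X] {f : X ≃ₜ X} {A : LinearCocycle f d} {x : X} {s : ℕ} {χ : Fin s → ℝ}
  {E : Fin s → Submodule ℝ (EuclideanSpace ℝ (Fin d))}

lemma IsOseledetsSplitting.exists_sum_eq (hE : A.IsOseledetsSplitting x χ E)
    (v : EuclideanSpace ℝ (Fin d)) : ∃ w : Fin s → _, (∀ j, w j ∈ E j) ∧ ∑ j, w j = v := by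
  obtain ⟨w, hw, hsum⟩ := (Submodule.mem_iSup_iff_exists_finsupp E v).1
    (hE.isInternal.submodule_iSup_eq_top ▸ Submodule.mem_top)
  exact ⟨w, hw, by rw [← hsum, Finsupp.sum_fintype _ _ fun _ => rfl]⟩

/-- Exponents in the direction of time given by the sign `σ`. -/
lemma IsOseledetsSplitting.tendsto_log (hE : A.IsOseledetsSplitting x χ E) {σ : ℤ}
    (hσ : σ = 1 ∨ σ = -1) {j : Fin s} {v : EuclideanSpace ℝ (Fin d)} (hv : v ∈ E j) (hv0 : v ≠ 0) :
    Tendsto (fun n : ℕ => 1 / (n : ℝ) * Real.log ‖A.act x (σ * n) v‖) atTop (𝓝 (σ * χ j)) := by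
  obtain ⟨h1, h2⟩ := hE.exponent j v hv hv0
  rcases hσ with rfl | rfl
  · simpa [Function.comp_def] using h1.comp (tendsto_natCast_atTop_atTop (R := ℤ))
  · have h := (h2.comp (tendsto_neg_atTop_atBot.comp (tendsto_natCast_atTop_atTop (R := ℤ)))).neg
    simpa [Function.comp_def, neg_div, one_div, inv_neg] using h

lemma scaledNorm_sign_mul {σ : ℤ} (lam : ℝ) (v : EuclideanSpace ℝ (Fin d)) (n : ℕ) :
    A.scaledNorm lam x v (σ * n) = Real.exp (-(σ * lam) * n) * ‖A.act x (σ * n) v‖ := by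
  rw [scaledNorm]
  congr 2
  push_cast
  ring

lemma IsOseledetsSplitting.tendsto_scaledNorm_zero (hE : A.IsOseledetsSplitting x χ E) {σ : ℤ}
    (hσ : σ = 1 ∨ σ = -1) {j : Fin s} {v : EuclideanSpace ℝ (Fin d)} (hv : v ∈ E j) {lam : ℝ}
    (hlam : σ * χ j < σ * lam) :
    Tendsto (fun n : ℕ => A.scaledNorm lam x v (σ * n)) atTop (𝓝 0) := by
  rcases eq_or_ne v 0 with rfl | hv0
  · simp [scaledNorm]
  simp_rw [scaledNorm_sign_mul]
  exact tendsto_exp_mul_zero_of_log (fun n => by simpa using hv0) (hE.tendsto_log hσ hv hv0) hlam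

lemma IsOseledetsSplitting.tendsto_scaledNorm_atTop (hE : A.IsOseledetsSplitting x χ E) {σ : ℤ}
    (hσ : σ = 1 ∨ σ = -1) {w : Fin s → EuclideanSpace ℝ (Fin d)} (hw : ∀ j, w j ∈ E j)
    {j : Fin s} (hj : w j ≠ 0) {lam : ℝ} (hlam : σ * lam < σ * χ j) :
    Tendsto (fun n : ℕ => A.scaledNorm lam x (∑ k, w k) (σ * n)) atTop atTop := by
  simp_rw [scaledNorm_sign_mul]
  refine tendsto_norm_sum_atTop (fun n : ℕ => A.act x (σ * n)) (ρ := fun j => (σ : ℝ) * χ j) ?_ w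
    (fun k hk => hE.tendsto_log hσ (hw k) hk) hj hlam
  have hσ' : (σ : ℝ) ≠ 0 := by rcases hσ with rfl | rfl <;> norm_num
  exact fun a b h => hE.strictAnti.injective (mul_left_cancel₀ hσ' h)

lemma IsOseledetsSplitting.eq_zero_of_bddAbove (hE : A.IsOseledetsSplitting x χ E) {σ : ℤ}
    (hσ : σ = 1 ∨ σ = -1) {w : Fin s → EuclideanSpace ℝ (Fin d)} (hw : ∀ j, w j ∈ E j)
    {lam : ℝ} (hb : BddAbove (Set.range fun n : ℕ => A.scaledNorm lam x (∑ k, w k) (σ * n)))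
    {j : Fin s} (hlam : σ * lam < σ * χ j) : w j = 0 := by
  by_contra hj
  exact not_bddAbove_of_tendsto_atTop (hE.tendsto_scaledNorm_atTop hσ hw hj hlam) hb

lemma IsOseledetsSplitting.exists_lt_scaledNorm (hE : A.IsOseledetsSplitting x χ E) {lam : ℝ}
    (hlam : ∀ j, χ j ≠ lam) {v : EuclideanSpace ℝ (Fin d)} (hv : v ≠ 0) (r : ℝ) :
    ∃ k : ℤ, r < A.scaledNorm lam x v k := by
  obtain ⟨w, hw, rfl⟩ := hE.exists_sum_eq v
  obtain ⟨j, -, hj⟩ := Finset.exists_ne_zero_of_sum_ne_zero hv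
  rcases (hlam j).lt_or_gt with h | h
  · obtain ⟨n, hn⟩ := ((hE.tendsto_scaledNorm_atTop (σ := -1) (lam := lam) (Or.inr rfl) hw hj
      (by simpa using h)).eventually_gt_atTop r).exists
    exact ⟨_, hn⟩
  · obtain ⟨n, hn⟩ := ((hE.tendsto_scaledNorm_atTop (σ := 1) (lam := lam) (Or.inl rfl) hw hj
      (by simpa using h)).eventually_gt_atTop r).exists
    exact ⟨_, hn⟩

end Oseledets

/-! ### Uniform estimates by compactness. -/

section Uniform

variable [TopologicalSpace X] [CompactSpace X] {f : X ≃ₜ X} {A : LinearCocycle f d}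
  {s : ℕ} {χ : Fin s → ℝ} {E : Fin s → X → Submodule ℝ (EuclideanSpace ℝ (Fin d))}

/-- The open sets where the rescaled norm exceeds 2 at time `k` cover the compact unit sphere
bundle; a finite subcover bounds `|k|`, and homogeneity removes the normalisation. -/
lemma exists_two_mul_norm_le (hE : ∀ x, A.IsOseledetsSplitting x χ fun i => E i x) {lam : ℝ}
    (hlam : ∀ j, χ j ≠ lam) :
    ∃ N : ℕ, ∀ x v, ∃ k : ℤ, |k| ≤ N ∧ 2 * ‖v‖ ≤ A.scaledNorm lam x v k := by
  have hK : IsCompact ((Set.univ : Set X) ×ˢ Metric.sphere (0 : EuclideanSpace ℝ (Fin d)) 1) :=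
    isCompact_univ.prod (isCompact_sphere 0 1)
  obtain ⟨t, ht⟩ := hK.elim_finite_subcover
    (fun k : ℤ => {p : X × EuclideanSpace ℝ (Fin d) | 2 < A.scaledNorm lam p.1 p.2 k})
    (fun k => isOpen_lt continuous_const (A.continuous_scaledNorm lam k)) fun p hp => by
      have hp0 : p.2 ≠ 0 := fun h => by simpa [h] using hp.2
      exact Set.mem_iUnion.2 ((hE p.1).exists_lt_scaledNorm hlam hp0 2)
  refine ⟨t.sup Int.natAbs, fun x v => ?_⟩
  rcases eq_or_ne v 0 with rfl | hv
  · exact ⟨0, by simp, by simp [scaledNorm]⟩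
  have hpos : 0 < ‖v‖ := norm_pos_iff.2 hv
  obtain ⟨k, hkt, hk⟩ := Set.mem_iUnion₂.1 (@ht (x, ‖v‖⁻¹ • v) ⟨Set.mem_univ _, by
    simp [norm_smul, hpos.ne']⟩)
  refine ⟨k, ?_, ?_⟩
  · rw [Int.abs_eq_natAbs]
    exact_mod_cast Finset.le_sup (f := Int.natAbs) hkt
  · replace hk : 2 < A.scaledNorm lam x (‖v‖⁻¹ • v) k := hk
    rw [scaledNorm_smul, abs_of_pos (inv_pos.2 hpos), inv_mul_eq_div, lt_div_iff₀ hpos] at hk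
    exact hk.le

/-- One-sided bounded orbits are uniformly bounded in terms of their initial vectors. -/
lemma exists_scaledNorm_le_of_bddAbove (hE : ∀ x, A.IsOseledetsSplitting x χ fun i => E i x)
    {lam : ℝ} (hlam : ∀ j, χ j ≠ lam) :
    ∃ C : ℝ, 0 < C ∧ ∀ σ : ℤ, (σ = 1 ∨ σ = -1) → ∀ x v,
      BddAbove (Set.range fun n : ℕ => A.scaledNorm lam x v (σ * n)) →
      ∀ n : ℕ, A.scaledNorm lam x v (σ * n) ≤ C * ‖v‖ := by
  obtain ⟨N, hN⟩ := exists_two_mul_norm_le hE hlam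
  obtain ⟨C, hC, hinit⟩ := A.exists_scaledNorm_le lam N
  refine ⟨C, hC, fun σ hσ x v hb => le_of_two_mul_le_of_bddAbove (N := N) (by positivity) hb
    (fun m hm => hinit x v _ ?_) fun n hn => ?_⟩
  · rcases hσ with rfl | rfl <;> simp <;> omega
  -- Doubling is applied to the orbit point at time `σ * n`. Since `|k| ≤ N ≤ n`, the shifted time
  -- stays on the same half-orbit.
  · obtain ⟨k, hk, hle⟩ := hN ((f ^ (σ * n)) x) (A.act x (σ * n) v)
    rw [scaledNorm_act] at hle
    obtain ⟨m, hm⟩ : ∃ m : ℕ, k + σ * n = σ * m := by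
      rw [abs_le] at hk
      rcases hσ with rfl | rfl
      · exact ⟨(k + n).toNat, by omega⟩
      · exact ⟨(n - k).toNat, by omega⟩
    refine ⟨m, ?_⟩
    rw [← hm]
    have h1 : 0 < Real.exp (lam * (σ * n : ℤ)) := Real.exp_pos _
    refine le_of_mul_le_mul_left ?_ h1
    refine le_trans (le_of_eq ?_) hle
    have h2 : Real.exp (lam * (σ * n : ℤ)) * Real.exp (-lam * (σ * n : ℤ)) = 1 := by
      rw [← Real.exp_add]; simp
    rw [scaledNorm]
    linear_combination (2 * ‖A.act x (σ * n) v‖) * h2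

/-- The bounds with exponents `χ i ± δ` in the two directions of time characterise `E i`. -/
lemma exists_mem_iff_scaledNorm_le (hE : ∀ x, A.IsOseledetsSplitting x χ fun i => E i x)
    (i : Fin s) {δ : ℝ} (hδ : 0 < δ) (hgap : ∀ j, j ≠ i → δ < |χ j - χ i|) :
    ∃ C : ℝ, 0 < C ∧ (∀ x v, v ∈ E i x ↔ ∀ σ : ℤ, (σ = 1 ∨ σ = -1) → ∀ n : ℕ,
        A.scaledNorm (χ i + σ * δ) x v (σ * n) ≤ C * ‖v‖) ∧
      ∀ x v (n : ℤ), v ∈ E i x → C⁻¹ * Real.exp (χ i * n - δ * |(n : ℝ)|) * ‖v‖ ≤ ‖A.act x n v‖ ∧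
        ‖A.act x n v‖ ≤ C * Real.exp (χ i * n + δ * |(n : ℝ)|) * ‖v‖ := by
  have hne : ∀ σ : ℤ, (σ = 1 ∨ σ = -1) → ∀ j, χ j ≠ χ i + σ * δ := by
    intro σ hσ j h
    have hj : j ≠ i := by
      rintro rfl
      rcases hσ with rfl | rfl <;> simp at h <;> linarith
    have := hgap j hj
    rw [h] at this
    rcases hσ with rfl | rfl <;> simp [abs_of_pos hδ] at this
  have hC : ∃ C : ℝ, 0 < C ∧ ∀ σ : ℤ, (σ = 1 ∨ σ = -1) → ∀ x v,
      BddAbove (Set.range fun n : ℕ => A.scaledNorm (χ i + σ * δ) x v (σ * n)) →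
      ∀ n : ℕ, A.scaledNorm (χ i + σ * δ) x v (σ * n) ≤ C * ‖v‖ := by
    obtain ⟨C₁, h₁, hC₁⟩ := exists_scaledNorm_le_of_bddAbove hE (hne 1 (Or.inl rfl))
    obtain ⟨C₂, h₂, hC₂⟩ := exists_scaledNorm_le_of_bddAbove hE (hne (-1) (Or.inr rfl))
    refine ⟨max C₁ C₂, lt_max_of_lt_left h₁, fun σ hσ x v hb n => ?_⟩
    rcases hσ with rfl | rfl
    · refine (hC₁ 1 (Or.inl rfl) x v hb n).trans ?_
      gcongr
      exact le_max_left _ _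
    · refine (hC₂ (-1) (Or.inr rfl) x v hb n).trans ?_
      gcongr
      exact le_max_right _ _
  obtain ⟨C, hC0, hC⟩ := hC
  have hzero : ∀ x v, v ∈ E i x → ∀ σ : ℤ, (σ = 1 ∨ σ = -1) →
      Tendsto (fun n : ℕ => A.scaledNorm (χ i + σ * δ) x v (σ * n)) atTop (𝓝 0) := by
    intro x v hv σ hσ
    refine (hE x).tendsto_scaledNorm_zero hσ hv ?_
    rcases hσ with rfl | rfl <;> simp [hδ]
  refine ⟨C, hC0, fun x v => ⟨fun hv σ hσ => hC σ hσ x v (hzero x v hv σ hσ).bddAbove_range,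
    fun h => ?_⟩, fun x v n hv => ?_⟩
  · obtain ⟨w, hw, rfl⟩ := (hE x).exists_sum_eq v
    have hwj : ∀ j, j ≠ i → w j = 0 := by
      intro j hj
      have hb : ∀ σ : ℤ, (σ = 1 ∨ σ = -1) → BddAbove (Set.range fun n : ℕ =>
          A.scaledNorm (χ i + σ * δ) x (∑ k, w k) (σ * n)) := by
        rintro σ hσ
        refine ⟨_, Set.forall_mem_range.2 (h σ hσ)⟩
      -- A component with `χ j > χ i + δ` violates the forward bound, one with `χ j < χ i - δ` the
      -- backward bound.
      rcases lt_abs.1 (hgap j hj) with h1 | h1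
      · exact (hE x).eq_zero_of_bddAbove (Or.inl rfl) hw (hb 1 (Or.inl rfl)) (by
          push_cast; linarith)
      · exact (hE x).eq_zero_of_bddAbove (Or.inr rfl) hw (hb (-1) (Or.inr rfl)) (by
          push_cast; linarith)
    rw [Finset.sum_eq_single i (fun j _ hj => hwj j hj) (by simp)]
    exact hw i
  · obtain ⟨σ, hσ, m, rfl⟩ : ∃ σ : ℤ, (σ = 1 ∨ σ = -1) ∧ ∃ m : ℕ, n = σ * m := by
      obtain ⟨m, rfl | rfl⟩ := n.eq_nat_or_neg
      · exact ⟨1, Or.inl rfl, m, by simp⟩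
      · exact ⟨-1, Or.inr rfl, m, by simp⟩
    have hσ' : -σ = 1 ∨ -σ = -1 := by rcases hσ with rfl | rfl <;> simp
    have habs : |((σ * m : ℤ) : ℝ)| = m := by rcases hσ with rfl | rfl <;> simp
    have hsq : (σ : ℝ) * σ = 1 := by rcases hσ with rfl | rfl <;> simp
    rw [habs]
    constructor
    -- For the lower bound, start at `A(x, σ m) v` and run time in the direction `-σ`. After `m`
    -- steps this orbit is back at `v` and then follows a decaying rescaled orbit of `v`, so it is
    -- bounded; the uniform bound at step `m` estimates `‖v‖`.
    · have hb : BddAbove (Set.range fun k : ℕ => A.scaledNorm (χ i + (-σ : ℤ) * δ)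
          ((f ^ (σ * m)) x) (A.act x (σ * m) v) (-σ * k)) := by
        refine Tendsto.bddAbove_range (a := 0) ((tendsto_add_atTop_iff_nat m).1 ?_)
        simp_rw [scaledNorm_act]
        have h := (hzero x v hv (-σ) hσ').const_mul
          (Real.exp ((χ i + (-σ : ℤ) * δ) * (σ * m : ℤ)))
        rw [mul_zero] at h
        refine h.congr fun k => ?_
        congr 2
        push_cast
        ring
      have h := hC (-σ) hσ' _ _ hb m
      rw [scaledNorm_act, neg_mul, neg_add_cancel, scaledNorm_zero] at h
      rw [mul_assoc, inv_mul_le_iff₀ hC0]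
      refine le_trans (le_of_eq ?_) h
      congr 2
      push_cast
      linear_combination (δ * m) * hsq
    · have h := hC σ hσ x v (hzero x v hv σ hσ).bddAbove_range m
      rw [scaledNorm, neg_mul, Real.exp_neg, inv_mul_le_iff₀ (Real.exp_pos _)] at h
      have hexp : (χ i + σ * δ) * (σ * m : ℤ) = χ i * (σ * m : ℤ) + δ * m := by
        push_cast
        linear_combination (δ * m) * hsq
      rw [hexp] at h
      linarith

end Uniform

end LinearCocycle

/-! ### From vector estimates to norms, co-norms and exponents. -/

lemma restrNorm_restrConorm_mem_Icc {d : ℕ}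
    (L : EuclideanSpace ℝ (Fin d) ≃L[ℝ] EuclideanSpace ℝ (Fin d))
    {F : Submodule ℝ (EuclideanSpace ℝ (Fin d))} (hF : F ≠ ⊥) {a b : ℝ} (ha : 0 < a)
    (h : ∀ v ∈ F, a * ‖v‖ ≤ ‖L v‖ ∧ ‖L v‖ ≤ b * ‖v‖) :
    restrNorm L F ∈ Set.Icc a b ∧ restrConorm L F ∈ Set.Icc a b := by
  obtain ⟨v, hv, hv0⟩ := Submodule.exists_mem_ne_zero_of_ne_bot hF
  have hpos : 0 < ‖v‖ := norm_pos_iff.2 hv0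
  have hab : a ≤ b := le_of_mul_le_mul_right ((h v hv).1.trans (h v hv).2) hpos
  have hb : 0 < b := ha.trans_le hab
  have hsymm : ∀ w, ‖(L.submoduleMap F).symm w‖ ≤ a⁻¹ * ‖w‖ := by
    intro w
    obtain ⟨u, rfl⟩ := (L.submoduleMap F).surjective w
    rw [ContinuousLinearEquiv.symm_apply_apply, ← div_eq_inv_mul, le_div_iff₀' ha]
    exact (h u u.2).1
  have hinv : b⁻¹ ≤ ‖(L.submoduleMap F).symm.toContinuousLinearMap‖ := by
    have h1 := (L.submoduleMap F).symm.toContinuousLinearMap.le_opNorm (L.submoduleMap F ⟨v, hv⟩)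
    rw [ContinuousLinearEquiv.coe_coe, ContinuousLinearEquiv.symm_apply_apply] at h1
    have h2 : ‖L.submoduleMap F ⟨v, hv⟩‖ ≤ b * ‖v‖ := (h v hv).2
    have h3 : ‖v‖ ≤ ‖(L.submoduleMap F).symm.toContinuousLinearMap‖ * (b * ‖v‖) :=
      h1.trans (by gcongr)
    rw [inv_le_iff_one_le_mul₀ hb]
    refine le_of_mul_le_mul_right ?_ hpos
    linarith
  have hinv' : ‖(L.submoduleMap F).symm.toContinuousLinearMap‖ ≤ a⁻¹ :=
    ContinuousLinearMap.opNorm_le_bound _ (by positivity) hsymm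
  refine ⟨⟨?_, ?_⟩, ?_, ?_⟩
  · have h1 := (L.submoduleMap F).toContinuousLinearMap.le_opNorm ⟨v, hv⟩
    exact le_of_mul_le_mul_right ((h v hv).1.trans h1) hpos
  · exact ContinuousLinearMap.opNorm_le_bound _ hb.le fun u => (h u u.2).2
  · exact (le_inv_comm₀ ((inv_pos.2 hb).trans_le hinv) ha).1 hinv'
  · exact inv_le_of_inv_le₀ hb hinv

lemma one_div_mul_log_mem_Icc {C χ δ ε r n : ℝ} (hC : 0 < C) (hn : n ≠ 0)
    (hδ : δ + |Real.log C| / |n| ≤ ε)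
    (hr : r ∈ Set.Icc (C⁻¹ * Real.exp (χ * n - δ * |n|)) (C * Real.exp (χ * n + δ * |n|))) :
    χ - ε ≤ 1 / n * Real.log r ∧ 1 / n * Real.log r ≤ χ + ε := by
  have hn' : 0 < |n| := abs_pos.2 hn
  have hr0 : 0 < r := lt_of_lt_of_le (by positivity) hr.1
  have h1 := Real.log_le_log (by positivity) hr.1
  have h2 := Real.log_le_log hr0 hr.2
  rw [Real.log_mul (by positivity) (by positivity), Real.log_exp, Real.log_inv] at h1
  rw [Real.log_mul (by positivity) (by positivity), Real.log_exp] at h2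
  have hlog := le_abs_self (Real.log C)
  have h3 : |Real.log r - χ * n| ≤ δ * |n| + |Real.log C| := abs_le.2 ⟨by linarith, by linarith⟩
  have h4 : |1 / n * Real.log r - χ| ≤ ε := by
    have : 1 / n * Real.log r - χ = (Real.log r - χ * n) / n := by field_simp
    rw [this, abs_div, div_le_iff₀ hn']
    refine h3.trans ?_
    calc δ * |n| + |Real.log C| = (δ + |Real.log C| / |n|) * |n| := by field_simp
      _ ≤ ε * |n| := by gcongr
  rw [abs_le] at h4
  constructor <;> linarith

lemma exists_pos_lt_forall_lt_abs_sub {s : ℕ} {χ : Fin s → ℝ} (hχ : Function.Injective χ)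
    (i : Fin s) {ε : ℝ} (hε : 0 < ε) : ∃ δ, 0 < δ ∧ δ < ε ∧ ∀ j, j ≠ i → δ < |χ j - χ i| := by
  have h : ∀ᶠ δ in 𝓝[>] (0 : ℝ), 0 < δ ∧ δ < ε ∧ ∀ j, j ≠ i → δ < |χ j - χ i| := by
    refine Eventually.and self_mem_nhdsWithin (Eventually.and ?_ ?_)
    · exact mem_nhdsWithin_of_mem_nhds (Iio_mem_nhds hε)
    · refine eventually_all.2 fun j => ?_
      by_cases hj : j = i
      · simp [hj]
      · filter_upwards [mem_nhdsWithin_of_mem_nhds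
          (Iio_mem_nhds (abs_pos.2 (sub_ne_zero.2 (hχ.ne hj))))] with δ hδ _ using hδ
  exact h.exists

theorem mainTheorem5 {X : Type*} [MetricSpace X] [CompactSpace X] (f : X ≃ₜ X) (d : ℕ)
    (A : LinearCocycle f d) (hA : A.IsCompletelyRegular)
    (s : ℕ) (χ : Fin s → ℝ) (E : Fin s → X → Submodule ℝ (EuclideanSpace ℝ (Fin d)))
    (hE : ∀ x, A.IsOseledetsSplitting x χ (fun i => E i x)) (i : Fin s) :
    ContinuousSubspaces (E i) ∧
    ∀ ε : ℝ, 0 < ε → ∃ N : ℕ, ∀ n : ℤ, (N : ℤ) < |n| → ∀ x : X,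
      (χ i - ε ≤ 1 / (n : ℝ) * Real.log (restrConorm (A.act x n) (E i x)) ∧
        1 / (n : ℝ) * Real.log (restrConorm (A.act x n) (E i x)) ≤ χ i + ε) ∧
      (χ i - ε ≤ 1 / (n : ℝ) * Real.log (restrNorm (A.act x n) (E i x)) ∧
        1 / (n : ℝ) * Real.log (restrNorm (A.act x n) (E i x)) ≤ χ i + ε) := by
  rcases isEmpty_or_nonempty X with hX | ⟨⟨x₀⟩⟩
  · exact ⟨continuous_of_const fun x => hX.elim x, fun _ _ => ⟨0, fun _ _ x => hX.elim x⟩⟩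
  have hχ : Function.Injective χ := (hE x₀).strictAnti.injective
  constructor
  · refine continuous_starProjection_of_isClosed E (fun j => ?_) (fun x => (hE x).isInternal) i
    obtain ⟨δ, hδ, -, hgap⟩ := exists_pos_lt_forall_lt_abs_sub hχ j one_pos
    obtain ⟨C, -, hmem, -⟩ := LinearCocycle.exists_mem_iff_scaledNorm_le hE j hδ hgap
    simp_rw [hmem, Set.ofPred_forall]
    refine isClosed_iInter fun σ => isClosed_iInter fun _ => isClosed_iInter fun n => ?_
    exact isClosed_le (A.continuous_scaledNorm _ _) (by fun_prop)
  · intro ε hε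
    obtain ⟨δ, hδ, hδε, hgap⟩ := exists_pos_lt_forall_lt_abs_sub hχ i hε
    obtain ⟨C, hC, -, hbound⟩ := LinearCocycle.exists_mem_iff_scaledNorm_le hE i hδ hgap
    -- Beyond this `N`, the constant `C` shifts the exponent by at most `|log C| / |n| < ε - δ`.
    obtain ⟨N, hN⟩ := exists_nat_gt (|Real.log C| / (ε - δ))
    refine ⟨N, fun n hn x => ?_⟩
    have hn' : (N : ℝ) < |(n : ℝ)| := by exact_mod_cast hn
    have hn0 : 0 < |(n : ℝ)| := (Nat.cast_nonneg N).trans_lt hn'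
    have hδn : δ + |Real.log C| / |(n : ℝ)| ≤ ε := by
      have h1 := hN.trans hn'
      rw [div_lt_comm₀ (sub_pos.2 hδε) hn0] at h1
      linarith
    obtain ⟨h1, h2⟩ := restrNorm_restrConorm_mem_Icc (A.act x n) ((hE x).ne_bot i)
      (by positivity) fun v hv => hbound x v n hv
    exact ⟨one_div_mul_log_mem_Icc hC (abs_pos.1 hn0) hδn h2,
      one_div_mul_log_mem_Icc hC (abs_pos.1 hn0) hδn h1⟩
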